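/- For integers $n\ge m\ge 0$ let the double star $S(n,m)$ be the graph obtained from the disjoint union of the stars $K_{1,n}$ and $K_{1,m}$ by adding the edge between their centers. For graphs $G,H$ let $gr_k(G:H)$ be the minimum integer $N$ such that every coloring of the edges of the complete graph $K_N$ with $k$ available colors contains a rainbow copy of $G$ (all edges of different colors) or a monochromatic copy of $H$. **Theorem.** Let $n,m,k$ be integers with $1\le m\le n\le 6m+6$ and $k\ge 3$. Then $$ gr_{k}(K_{3} : S(n,m))\leq \begin{cases} \max\{5\cdot\frac{n+2}{2},\,2n+6m+7\} + m(k-3)+1 & \text{if $n$ is even,}\\ \max\{5\cdot\frac{n+1}{2},\,2n+6m+7\}+ m(k-3)+ 2 & \text{if $n$ is odd,} \end{cases} $$ and $$ gr_{k}(K_{3} : S(n,m))\geq \begin{cases} \max\{5\cdot\frac{n}{2},\,n+3m+1\} + m(k-3)+1 & \text{if $n$ is even,}\\ \max\{5\cdot\frac{n-1}{2},\,n+3m\}+ m(k-3)+ 2 & \text{if $n$ is odd.} \end{cases} $$ -/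

import Mathlib

namespace SimpleGraph

/-- The double star `S(n,m)`: the disjoint union of the stars `K_{1,n}` and `K_{1,m}` together with
the edge joining their centers. -/
def doubleStar (n m : ℕ) : SimpleGraph ((Fin 1 ⊕ Fin n) ⊕ (Fin 1 ⊕ Fin m)) :=
  (completeBipartiteGraph (Fin 1) (Fin n) ⊕g completeBipartiteGraph (Fin 1) (Fin m)) ⊔
    edge (Sum.inl (Sum.inl 0)) (Sum.inr (Sum.inl 0))

/-- The edge coloring `C` of a complete graph contains a rainbow copy of `G`: a (not necessarily
induced) copy of `G` whose edges have pairwise distinct colors. -/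
def HasRainbowCopy {W V K : Type*} (G : SimpleGraph W) (C : TopEdgeLabeling V K) : Prop :=
  ∃ f : Copy G (⊤ : SimpleGraph V), Function.Injective fun e : G.edgeSet => C (f.mapEdgeSet e)

/-- The edge coloring `C` of a complete graph contains a monochromatic copy of `H`: a (not
necessarily induced) copy of `H` all of whose edges have the same color. -/
def HasMonochromaticCopy {W V K : Type*} (H : SimpleGraph W) (C : TopEdgeLabeling V K) : Prop :=
  ∃ c : K, H ⊑ C.labelGraph c

/-- The Gallai-Ramsey number `gr_k(G : H)`: the least `N` such that every coloring of the edges of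
the complete graph on `N` vertices with `k` available colors contains a rainbow copy of `G` or a
monochromatic copy of `H`. (If there were no such `N` the value would be `0`, so any positive lower
bound on it includes the existence of such an `N`.) -/
noncomputable def gallaiRamsey {W W' : Type*} (k : ℕ) (G : SimpleGraph W) (H : SimpleGraph W') :
    ℕ :=
  sInf {N : ℕ | ∀ C : TopEdgeLabeling (Fin N) (Fin k),
    HasRainbowCopy G C ∨ HasMonochromaticCopy H C}

end SimpleGraph

/-!
Upper bound. In an edge coloring without a monochromatic `S(n,m)`, the neighbors of a vertex whose
degree in some color exceeds `n + m` have degree at most `m` in that color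
(`card_colorNeighbors_le`), and a monochromatic complete bipartite graph with more than `n` vertices
on one side has at most `m` on the other (`card_le_of_complete`).

Call a set of vertices homogeneous if every vertex outside it sees it in one color, and let `R` be a
smallest homogeneous set with more than `n` vertices. For each color at most `m` outside vertices
see `R` in that color. If there is no rainbow triangle, then `R` has a Gallai partition: a partition
into at least two homogeneous parts with only two colors `r` and `b` between them
(`exists_not_reachable_otherColors`, `color_eq_of_reachable`). By minimality the parts have at most
`n` vertices. So every vertex of `R` has total degree at least `n + 5m + 8` in the colors `r` and
`b`; in particular, if its degree in one of them is at most `m`, then its degree in the other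
exceeds `n + m`. Playing this off against the first observation shows that no vertex of `R` has
degree more than `n + m` in either color (`card_colorNeighbors_lt`). Hence each part has at least
`3m + 8` vertices. Since `|R| > 2n`, there are at least three parts, and among three of them one is
joined to the other two in the same color; as `n ≤ 6m + 6`, these contain `S(n,m)`.

Lower bound. Start from a core: either the `2`-coloring of `K₅` by two `5`-cycles, blown up to
classes of about `n / 2` vertices with a third color inside, so that all degrees are at most `n`, or
a monochromatic complete graph on `n + m + 1` vertices. For each remaining color add a block of `m`
vertices, joined in this color to everything before it and colored inside with a color of the core
(`lt_gallaiRamsey_of_core`). An edge between a block and earlier vertices has an end of degree at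
most `m` in the color of the block, so it does not join the centers of an `S(n,m)`.
-/

namespace SimpleGraph

/-! ### Double stars and rainbow triangles in terms of vertices -/

/-- The sets `A` and `B` are the leaves at the two centers `u` and `v`. -/
theorem doubleStar_isContained_iff {V : Type*} {G : SimpleGraph V} {n m : ℕ} :
    doubleStar n m ⊑ G ↔ ∃ (u v : V) (A B : Finset V), G.Adj u v ∧ A.card = n ∧ B.card = m ∧
      Disjoint A B ∧ (∀ a ∈ A, G.Adj u a ∧ a ≠ v) ∧ (∀ b ∈ B, G.Adj v b ∧ b ≠ u) := by
  classical
  constructor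
  · rintro ⟨f⟩
    have inj := f.injective
    have adj : ∀ x y, (doubleStar n m).Adj x y → G.Adj (f x) (f y) := fun x y h =>
      f.toHom.map_adj h
    refine ⟨f (.inl (.inl 0)), f (.inr (.inl 0)),
      Finset.univ.image fun i : Fin n => f (.inl (.inr i)),
      Finset.univ.image fun i : Fin m => f (.inr (.inr i)), ?_, ?_, ?_, ?_, ?_, ?_⟩
    · apply adj; simp [doubleStar, edge_adj]
    · rw [Finset.card_image_of_injective _ (fun i j h => by simpa using inj h)]; simp
    · rw [Finset.card_image_of_injective _ (fun i j h => by simpa using inj h)]; simp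
    · rw [Finset.disjoint_left]
      intro a ha hb
      simp only [Finset.mem_image, Finset.mem_univ, true_and] at ha hb
      obtain ⟨i, rfl⟩ := ha
      obtain ⟨j, hj⟩ := hb
      simpa using inj hj
    · intro a ha
      simp only [Finset.mem_image, Finset.mem_univ, true_and] at ha
      obtain ⟨i, rfl⟩ := ha
      exact ⟨adj _ _ (by simp [doubleStar]), fun h => by simpa using inj h⟩
    · intro a ha
      simp only [Finset.mem_image, Finset.mem_univ, true_and] at ha
      obtain ⟨i, rfl⟩ := ha
      exact ⟨adj _ _ (by simp [doubleStar]), fun h => by simpa using inj h⟩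
  · rintro ⟨u, v, A, B, huv, hA, hB, hAB, hAu, hBv⟩
    let eA := (A.equivFinOfCardEq hA).symm
    let eB := (B.equivFinOfCardEq hB).symm
    rw [Finset.disjoint_left] at hAB
    have hA' : ∀ i, G.Adj u (eA i) ∧ (eA i : V) ≠ v := fun i => hAu _ (eA i).2
    have hB' : ∀ i, G.Adj v (eB i) ∧ (eB i : V) ≠ u := fun i => hBv _ (eB i).2
    have hABe : ∀ i j, (eA i : V) ≠ eB j := fun i j h => hAB (eA i).2 (h ▸ (eB j).2)
    let g : (Fin 1 ⊕ Fin n) ⊕ (Fin 1 ⊕ Fin m) → V :=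
      Sum.elim (Sum.elim (fun _ => u) fun i => eA i) (Sum.elim (fun _ => v) fun i => eB i)
    have hg : Function.Injective g := by
      rintro ((x | x) | (x | x)) ((y | y) | (y | y)) h
      all_goals simp only [g, Sum.elim_inl, Sum.elim_inr] at h
      · rw [Subsingleton.elim x y]
      · exact absurd h (hA' y).1.ne
      · exact absurd h huv.ne
      · exact absurd h.symm (hB' y).2
      · exact absurd h.symm (hA' x).1.ne
      · rw [eA.injective (Subtype.ext h)]
      · exact absurd h (hA' x).2
      · exact absurd h (hABe _ _)
      · exact absurd h.symm huv.ne
      · exact absurd h.symm (hA' y).2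
      · rw [Subsingleton.elim x y]
      · exact absurd h (hB' y).1.ne
      · exact absurd h (hB' x).2
      · exact absurd h.symm (hABe _ _)
      · exact absurd h.symm (hB' x).1.ne
      · rw [eB.injective (Subtype.ext h)]
    refine ⟨⟨⟨g, ?_⟩, hg⟩⟩
    rintro ((x | x) | (x | x)) ((y | y) | (y | y)) h
    all_goals simp [doubleStar, edge_adj] at h
    all_goals simp only [g, Sum.elim_inl, Sum.elim_inr]
    exacts [(hA' _).1, huv, (hA' _).1.symm, huv.symm, (hB' _).1, (hB' _).1.symm]

theorem hasRainbowCopy_completeGraph_three_iff {V K : Type*} {C : TopEdgeLabeling V K} :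
    HasRainbowCopy (completeGraph (Fin 3)) C ↔ ∃ (x y z : V) (hxy : x ≠ y) (hxz : x ≠ z)
      (hyz : y ≠ z), C.get x y hxy ≠ C.get x z hxz ∧ C.get x y hxy ≠ C.get y z hyz ∧
        C.get x z hxz ≠ C.get y z hyz := by
  constructor
  · rintro ⟨f, hf⟩
    have e : ∀ i j : Fin 3, i ≠ j → s(i, j) ∈ (completeGraph (Fin 3)).edgeSet := by
      intro i j h; simpa using h
    have key : ∀ (i j k l : Fin 3) (h : i ≠ j) (h' : k ≠ l), s(i, j) ≠ s(k, l) →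
        C.get (f i) (f j) (f.injective.ne h) ≠ C.get (f k) (f l) (f.injective.ne h') := by
      intro i j k l h h' hne heq
      have := @hf ⟨s(i, j), e i j h⟩ ⟨s(k, l), e k l h'⟩ heq
      exact hne (congrArg Subtype.val this)
    have h01 : (0 : Fin 3) ≠ 1 := by decide
    have h02 : (0 : Fin 3) ≠ 2 := by decide
    have h12 : (1 : Fin 3) ≠ 2 := by decide
    exact ⟨f 0, f 1, f 2, f.injective.ne h01, f.injective.ne h02, f.injective.ne h12,
      key _ _ _ _ h01 h02 (by decide), key _ _ _ _ h01 h12 (by decide),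
      key _ _ _ _ h02 h12 (by decide)⟩
  · rintro ⟨x, y, z, hxy, hxz, hyz, h1, h2, h3⟩
    have hg : Function.Injective ![x, y, z] := by
      clear h1 h2 h3
      intro i j h
      fin_cases i <;> fin_cases j <;> simp_all
    refine ⟨⟨⟨![x, y, z], fun {a b} h => hg.ne h.ne⟩, hg⟩, ?_⟩
    have e : ∀ (i j : Fin 3) (h : ![x, y, z] i ≠ ![x, y, z] j), i < j →
        C.get _ _ h = C.get x y hxy ∧ i = 0 ∧ j = 1 ∨ C.get _ _ h = C.get x z hxz ∧ i = 0 ∧ j = 2 ∨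
        C.get _ _ h = C.get y z hyz ∧ i = 1 ∧ j = 2 := by
      intro i j h hij
      fin_cases i <;> fin_cases j <;> first | exact absurd hij (by decide) | simp
    have red : ∀ q : (completeGraph (Fin 3)).edgeSet, ∃ (i j : Fin 3) (hij : i < j),
        q = ⟨s(i, j), by simpa using hij.ne⟩ := by
      rintro ⟨q, hq⟩
      induction q using Sym2.inductionOn with
      | hf i j =>
        have hne : i ≠ j := by simpa using hq
        rcases lt_or_gt_of_ne hne with h | h
        · exact ⟨i, j, h, rfl⟩
        · exact ⟨j, i, h, Subtype.ext Sym2.eq_swap⟩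
    intro p q hpq
    obtain ⟨i, j, hij, rfl⟩ := red p
    obtain ⟨i', j', hij', rfl⟩ := red q
    have hpq' : C.get _ _ (hg.ne hij.ne) = C.get _ _ (hg.ne hij'.ne) := hpq
    have E1 := e i j (hg.ne hij.ne) hij
    have E2 := e i' j' (hg.ne hij'.ne) hij'
    rw [hpq'] at E1
    generalize C.get _ _ (hg.ne hij'.ne) = c at E1 E2
    apply Subtype.ext
    grind

/-! ### Gallai partitions -/

/-- The coloring `c` of the pairs of `V` has no rainbow triangle. The values of `c` on the diagonal
are irrelevant. -/
def IsGallaiColoring {V K : Type*} (c : V → V → K) : Prop :=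
  ∀ x y z, x ≠ y → x ≠ z → y ≠ z → c x y = c x z ∨ c x y = c y z ∨ c x z = c y z

/-- The graph on the vertices in `R` formed by the edges of all colors other than `r` and `b`
(the vertices outside `R` are isolated). Its components are the parts of a Gallai partition of `R`
whenever it is disconnected on `R`. -/
def otherColors {V K : Type*} (c : V → V → K) (R : Finset V) (r b : K) : SimpleGraph V :=
  fromRel fun x y => x ∈ R ∧ y ∈ R ∧ c x y ≠ r ∧ c x y ≠ b

section

variable {V K : Type*} {c : V → V → K} {R : Finset V} {r b : K}

theorem otherColors_adj (hs : ∀ x y, c x y = c y x) {x y : V} :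
    (otherColors c R r b).Adj x y ↔ x ≠ y ∧ x ∈ R ∧ y ∈ R ∧ c x y ≠ r ∧ c x y ≠ b := by
  rw [otherColors, fromRel_adj, hs y x]
  tauto

theorem color_of_not_reachable (hs : ∀ x y, c x y = c y x) {x y : V} (hx : x ∈ R) (hy : y ∈ R)
    (h : ¬(otherColors c R r b).Reachable x y) : c x y = r ∨ c x y = b := by
  by_contra! h'
  have hne : x ≠ y := by rintro rfl; exact h .rfl
  exact h ((otherColors_adj hs).2 ⟨hne, hx, hy, h'⟩).reachable

theorem not_reachable_of_cut (hs : ∀ x y, c x y = c y x) (H : V → Prop)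
    (hH : ∀ x ∈ R, ∀ y ∈ R, H x → ¬H y → c x y = r ∨ c x y = b) {u v : V} (hu : H u)
    (hv : ¬H v) : ¬(otherColors c R r b).Reachable u v := by
  rintro ⟨p⟩
  induction p with
  | nil => exact hv hu
  | cons h p ih =>
    rw [otherColors_adj hs] at h
    refine ih ?_ hv
    by_contra hw
    rcases hH _ h.2.1 _ h.2.2.1 hu hw with e | e
    · exact h.2.2.2.1 e
    · exact h.2.2.2.2 e

/-- The components of `otherColors c R r b` are homogeneous: if `xw` is an edge with a third color,
then a rainbow triangle `xwy` is avoided only if `xy` and `wy` have the same color. -/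
theorem color_eq_of_reachable (hs : ∀ x y, c x y = c y x) (hc : IsGallaiColoring c) {x x' y : V}
    (hy : y ∈ R) (h : (otherColors c R r b).Reachable x x')
    (hxy : ¬(otherColors c R r b).Reachable x y) : c x y = c x' y := by
  obtain ⟨p⟩ := h
  induction p with
  | nil => rfl
  | cons h p ih =>
    rename_i x w x'
    have hwy : ¬(otherColors c R r b).Reachable w y := fun h' => hxy (h.reachable.trans h')
    rw [← ih hwy]
    have hne : x ≠ y := by rintro rfl; exact hxy .rfl
    have hne' : w ≠ y := by rintro rfl; exact hwy .rfl
    rw [otherColors_adj hs] at h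
    have h1 := color_of_not_reachable hs h.2.1 hy hxy
    have h2 := color_of_not_reachable hs h.2.2.1 hy hwy
    have := hc x w y h.1 hne hne'
    grind

/-- Gallai's theorem: some two colors separate the vertex set. The proof removes a vertex `x` and
follows how `x` attaches to the parts of a Gallai partition of the remaining vertices. -/
theorem exists_not_reachable_otherColors [DecidableEq V] (hs : ∀ x y, c x y = c y x)
    (hc : IsGallaiColoring c) (R : Finset V) (hR : 2 ≤ R.card) :
    ∃ r b, ∃ u ∈ R, ∃ v ∈ R, ¬(otherColors c R r b).Reachable u v := by
  induction R using Finset.induction_on with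
  | empty => simp at hR
  | insert x R hx ih =>
    rw [Finset.card_insert_of_notMem hx] at hR
    rcases Nat.lt_or_ge R.card 2 with hR1 | hR2
    · obtain ⟨y, rfl⟩ := Finset.card_eq_one.1 (show R.card = 1 by omega)
      have hxy : y ≠ x := by rintro rfl; simp at hx
      refine ⟨c x y, c x y, x, by simp, y, by simp, ?_⟩
      exact not_reachable_of_cut hs (· = x) (by simp; grind) rfl hxy
    obtain ⟨r, b, u, hu, v, hv, huv⟩ := ih hR2
    set F := otherColors c R r b with hF
    have hne : ∀ y ∈ R, x ≠ y := by rintro y hy rfl; exact hx hy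
    by_cases hA : ∃ y ∈ R, ∀ z ∈ R, F.Reachable y z → c x z = r ∨ c x z = b
    · -- A part that `x` sees in the two colors only is still separated from the rest.
      obtain ⟨y, hy, hyz⟩ := hA
      refine ⟨r, b, y, by simp [hy], x, by simp, ?_⟩
      refine not_reachable_of_cut hs (fun z => z ∈ R ∧ F.Reachable y z) ?_ ⟨hy, .rfl⟩
        (fun h => hx h.1)
      rintro z hz w hw ⟨hzR, hyz'⟩ hnw
      rcases Finset.mem_insert.1 hw with rfl | hwR
      · rw [hs]; exact hyz z hzR hyz'
      · exact color_of_not_reachable hs hzR hwR fun h => hnw ⟨hwR, hyz'.trans h⟩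
    push Not at hA
    -- Otherwise all third colors at `x` are the same color `e`.
    obtain ⟨u', hu', huu', hur, hub⟩ := hA u hu
    obtain ⟨v', hv', hvv', hvr, hvb⟩ := hA v hv
    have huv' : ¬F.Reachable u' v' := fun h => huv (huu'.trans (h.trans hvv'.symm))
    have key : ∀ y ∈ R, ∀ z ∈ R, ¬F.Reachable y z → c x y = c x z ∨ c x y = c y z ∨
        c x z = c y z := fun y hy z hz h =>
      hc x y z (hne y hy) (hne z hz) (by rintro rfl; exact h .rfl)
    have hcol : ∀ y ∈ R, ∀ z ∈ R, ¬F.Reachable y z → c y z = r ∨ c y z = b :=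
      fun y hy z hz h => color_of_not_reachable hs hy hz h
    obtain ⟨e, he⟩ : ∃ e, c x u' = e := ⟨_, rfl⟩
    have hev : c x v' = e := by
      have := key _ hu' _ hv' huv'
      have := hcol _ hu' _ hv' huv'
      grind
    have hall : ∀ z ∈ R, c x z ≠ r → c x z ≠ b → c x z = e := by
      intro z hz h1 h2
      by_cases h : F.Reachable u' z
      · have h' : ¬F.Reachable v' z := fun h' => huv' (h.trans h'.symm)
        have := key _ hv' _ hz h'
        have := hcol _ hv' _ hz h'
        grind
      · have := key _ hu' _ hz h
        have := hcol _ hu' _ hz h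
        grind
    have her : e ≠ r := he ▸ hur
    have heb : e ≠ b := he ▸ hub
    by_cases hB : ∀ y ∈ R, c x y = e
    · refine ⟨e, e, x, by simp, u, by simp [hu], ?_⟩
      refine not_reachable_of_cut hs (· = x) ?_ rfl (hne u hu).symm
      rintro z hz w hw rfl hwz
      left
      exact hB w (Finset.mem_of_mem_insert_of_ne hw hwz)
    push Not at hB
    -- The part of a vertex `y` with `xy` of another color `f` sees everything else in `e` and `f`.
    obtain ⟨y, hy, hye⟩ := hB
    obtain ⟨f, hf⟩ : ∃ f, c x y = f := ⟨_, rfl⟩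
    have hcross : ∀ y' ∈ R, ∀ z ∈ R, F.Reachable y y' → ¬F.Reachable y z → c y' z = f := by
      intro y' hy' z hz hyy' hyz
      obtain ⟨z', hz', hzz', hzr, hzb⟩ := hA z hz
      have hyz' : ¬F.Reachable y z' := fun h => hyz (h.trans hzz'.symm)
      have h1 := hall z' hz' hzr hzb
      have h2 := key _ hy _ hz' hyz'
      have h3 := hcol _ hy _ hz' hyz'
      have h4 : c y z = c y' z := color_eq_of_reachable hs hc hz hyy' hyz
      have h5 : c z y = c z' y :=
        color_eq_of_reachable hs hc hy hzz' (fun h => hyz h.symm)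
      rw [← h4, hs, h5, hs]
      grind
    refine ⟨f, e, y, by simp [hy], x, by simp, ?_⟩
    refine not_reachable_of_cut hs (fun z => z ∈ R ∧ F.Reachable y z) ?_ ⟨hy, .rfl⟩
      (fun h => hx h.1)
    rintro y' - w hw ⟨hy', hyy'⟩ hnw
    rcases Finset.mem_insert.1 hw with rfl | hwR
    · rw [hs]
      obtain ⟨z, hz, hxz, hyz⟩ : ∃ z ∈ R, c w z = e ∧ ¬F.Reachable y z := by
        by_cases h : F.Reachable y u'
        · exact ⟨v', hv', hev, fun h' => huv' (h.symm.trans h')⟩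
        · exact ⟨u', hu', he, h⟩
      have h1 := hcross y' hy' z hz hyy' hyz
      have h2 := key y' hy' z hz (fun h => hyz (hyy'.trans h))
      grind
    · exact Or.inl (hcross y' hy' w hwR hyy' fun h => hnw ⟨hwR, h⟩)

/-- In `exists_not_reachable_otherColors` the two colors may be taken to be distinct. -/
theorem exists_ne_not_reachable_otherColors [DecidableEq V] [Nontrivial K]
    (hs : ∀ x y, c x y = c y x) (hc : IsGallaiColoring c) (R : Finset V) (hR : 2 ≤ R.card) :
    ∃ r b, r ≠ b ∧ ∃ u ∈ R, ∃ v ∈ R, ¬(otherColors c R r b).Reachable u v := by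
  obtain ⟨r, b, u, hu, v, hv, h⟩ := exists_not_reachable_otherColors hs hc R hR
  rcases ne_or_eq r b with hrb | rfl
  · exact ⟨r, b, hrb, u, hu, v, hv, h⟩
  · obtain ⟨b, hb⟩ := exists_ne r
    refine ⟨r, b, hb.symm, u, hu, v, hv, fun h' => h (h'.mono ?_)⟩
    intro x y hxy
    rw [otherColors_adj hs] at hxy ⊢
    tauto

end

/-! ### Avoiding a monochromatic double star -/

/-- The coloring `c` of the pairs of `V` has a double star `S(n,m)` in color `i`: with centers `u`
and `v`, the `n` leaves `A` at `u` and the `m` leaves `B` at `v`. -/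
def HasDoubleStar {V K : Type*} (c : V → V → K) (i : K) (n m : ℕ) : Prop :=
  ∃ (u v : V) (A B : Finset V), (u ≠ v ∧ c u v = i) ∧ A.card = n ∧ B.card = m ∧
    Disjoint A B ∧ (∀ a ∈ A, (u ≠ a ∧ c u a = i) ∧ a ≠ v) ∧ (∀ b ∈ B, (v ≠ b ∧ c v b = i) ∧ b ≠ u)

section

variable {V K : Type*} {c : V → V → K} {i : K} {n m : ℕ}

theorem hasDoubleStar_of_le (u v : V) (A B : Finset V) (huv : u ≠ v ∧ c u v = i)
    (hA : n ≤ A.card) (hB : m ≤ B.card) (hAB : Disjoint A B)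
    (hAu : ∀ a ∈ A, (u ≠ a ∧ c u a = i) ∧ a ≠ v) (hBv : ∀ b ∈ B, (v ≠ b ∧ c v b = i) ∧ b ≠ u) :
    HasDoubleStar c i n m := by
  obtain ⟨A', hA', hAc⟩ := Finset.exists_subset_card_eq hA
  obtain ⟨B', hB', hBc⟩ := Finset.exists_subset_card_eq hB
  exact ⟨u, v, A', B', huv, hAc, hBc, Finset.disjoint_of_subset_left hA'
    (Finset.disjoint_of_subset_right hB' hAB), fun a h => hAu a (hA' h), fun b h => hBv b (hB' h)⟩

/-- One side of a monochromatic complete bipartite graph whose other side has more than `n` vertices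
has at most `m` vertices. -/
theorem card_le_of_complete (hs : ∀ x y, c x y = c y x)
    (hd : ¬HasDoubleStar c i n m) (X Y : Finset V) (hXY : Disjoint X Y)
    (h : ∀ x ∈ X, ∀ y ∈ Y, c x y = i) (hY : n + 1 ≤ Y.card) : X.card ≤ m := by
  classical
  by_contra! hX
  obtain ⟨x, hx⟩ : X.Nonempty := Finset.card_pos.1 (by omega)
  obtain ⟨y, hy⟩ : Y.Nonempty := Finset.card_pos.1 (by omega)
  have hne : ∀ a ∈ X, ∀ b ∈ Y, a ≠ b := fun a ha b hb hab =>
    Finset.disjoint_left.1 hXY ha (hab ▸ hb)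
  refine hd (hasDoubleStar_of_le x y (Y.erase y) (X.erase x) ⟨hne x hx y hy, h x hx y hy⟩
    ?_ ?_ ?_ ?_ ?_)
  · rw [Finset.card_erase_of_mem hy]; omega
  · rw [Finset.card_erase_of_mem hx]; omega
  · exact Finset.disjoint_of_subset_left (Finset.erase_subset _ _)
      (Finset.disjoint_of_subset_right (Finset.erase_subset _ _) hXY.symm)
  · intro a ha
    rw [Finset.mem_erase] at ha
    exact ⟨⟨hne x hx a ha.2, h x hx a ha.2⟩, ha.1⟩
  · intro b hb
    rw [Finset.mem_erase] at hb
    exact ⟨⟨(hne b hb.2 y hy).symm, by rw [hs]; exact h b hb.2 y hy⟩, hb.1⟩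

/-- Three pairwise disjoint homogeneous sets with more than `m` vertices in the first and more than
`n` in the other two together yield a double star if the first is joined to both in one color. -/
theorem hasDoubleStar_of_three_sets (hs : ∀ x y, c x y = c y x) (X Y Z : Finset V)
    (hXY : Disjoint X Y) (hXZ : Disjoint X Z) (hYZ : Disjoint Y Z)
    (hY : ∀ x ∈ X, ∀ y ∈ Y, c x y = i) (hZ : ∀ x ∈ X, ∀ z ∈ Z, c x z = i)
    (hX : m < X.card) (hn : n + 1 ≤ Y.card + Z.card) : HasDoubleStar c i n m := by
  classical
  by_contra hd
  refine absurd hX (card_le_of_complete hs hd X (Y ∪ Z) ?_ ?_ ?_).not_gt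
  · exact Finset.disjoint_union_right.2 ⟨hXY, hXZ⟩
  · intro x hx y hy
    rcases Finset.mem_union.1 hy with h | h
    exacts [hY x hx y h, hZ x hx y h]
  · rwa [Finset.card_union_of_disjoint hYZ]

variable [Fintype V] [DecidableEq V] [DecidableEq K]

/-- The vertices joined to `x` in color `i`. -/
def colorNeighbors (c : V → V → K) (i : K) (x : V) : Finset V :=
  Finset.univ.filter fun y => x ≠ y ∧ c x y = i

theorem mem_colorNeighbors {x y : V} : y ∈ colorNeighbors c i x ↔ x ≠ y ∧ c x y = i := by
  simp [colorNeighbors]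

/-- A neighbor, in some color, of a vertex of degree more than `n + m` in that color has degree at
most `m` in it: otherwise choose `m` leaves at `v` first, and then `n` leaves at `u`. -/
theorem card_colorNeighbors_le (hs : ∀ x y, c x y = c y x) (hd : ¬HasDoubleStar c i n m) {u v : V}
    (huv : u ≠ v) (hc : c u v = i) (hu : n + m + 1 ≤ (colorNeighbors c i u).card) :
    (colorNeighbors c i v).card ≤ m := by
  by_contra! hv
  have h1 : u ∈ colorNeighbors c i v := mem_colorNeighbors.2 ⟨huv.symm, by rw [hs, hc]⟩
  have h2 : v ∈ colorNeighbors c i u := mem_colorNeighbors.2 ⟨huv, hc⟩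
  have h3 : m ≤ ((colorNeighbors c i v).erase u).card := by
    rw [Finset.card_erase_of_mem h1]; omega
  obtain ⟨B, hB, hBc⟩ := Finset.exists_subset_card_eq h3
  have h4 := Finset.le_card_sdiff B ((colorNeighbors c i u).erase v)
  rw [Finset.card_erase_of_mem h2] at h4
  refine hd (hasDoubleStar_of_le u v (((colorNeighbors c i u).erase v) \ B) B ⟨huv, hc⟩
    (by omega) hBc.ge Finset.sdiff_disjoint ?_ ?_)
  · intro a ha
    rw [Finset.mem_sdiff, Finset.mem_erase, mem_colorNeighbors] at ha
    exact ⟨ha.1.2, ha.1.1⟩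
  · intro b hb
    have := hB hb
    rw [Finset.mem_erase, mem_colorNeighbors] at this
    exact ⟨this.2, this.1⟩

/-! ### The upper bound -/

/-- Let `R` be a homogeneous set with parts `P x` of size at most `n`, the colors between the parts
being `r` and `b`. Then no vertex of `R` has degree more than `n + m` in color `r`.

If `v` did, some neighbor `a` of `v` in another part would have small `r`-degree, hence large
`b`-degree, so the `b`-neighbors of `a` in `R` would have small `b`-degree and thus large
`r`-degree. So no two of them are joined in color `r`, and those outside the part of one of them are
all its `b`-neighbors, which are too few. -/
theorem card_colorNeighbors_lt {r b : K} (hs : ∀ x y, c x y = c y x)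
    (hr : ¬HasDoubleStar c r n m) (hb : ¬HasDoubleStar c b n m)
    (R : Finset V) (P : V → Finset V) (hRcard : 2 * n + 3 * m + 8 ≤ R.card)
    (hPself : ∀ x ∈ R, x ∈ P x) (hPcard : ∀ x ∈ R, (P x).card ≤ n)
    (hP : ∀ x ∈ R, ∀ y ∈ R, y ∉ P x → c x y = r ∨ c x y = b)
    (hout : ∀ x ∈ R, (colorNeighbors c r x \ R).card ≤ m)
    (hdeg : ∀ x ∈ R,
      n + 5 * m + 8 ≤ (colorNeighbors c r x).card + (colorNeighbors c b x).card)
    {v : V} (hv : v ∈ R) : (colorNeighbors c r v).card < n + m + 1 := by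
  by_contra! hbig
  obtain ⟨a, ha, haP, hva⟩ : ∃ a ∈ R, a ∉ P v ∧ c v a = r := by
    by_contra! h
    have hsub : colorNeighbors c r v ⊆ (colorNeighbors c r v \ R) ∪ (P v).erase v := by
      intro a ha
      rw [Finset.mem_union, Finset.mem_sdiff, Finset.mem_erase]
      have := mem_colorNeighbors.1 ha
      by_cases haR : a ∈ R
      · refine .inr ⟨this.1.symm, ?_⟩
        by_contra haP
        exact h a haR haP this.2
      · exact .inl ⟨ha, haR⟩
    have h1 := (Finset.card_le_card hsub).trans (Finset.card_union_le _ _)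
    rw [Finset.card_erase_of_mem (hPself v hv)] at h1
    have := hout v hv
    have := hPcard v hv
    omega
  have hav : v ≠ a := by rintro rfl; exact haP (hPself _ hv)
  have ha_small := card_colorNeighbors_le hs hr hav hva hbig
  have ha_big : n + m + 1 ≤ (colorNeighbors c b a).card := by
    have := hdeg a ha
    omega
  set B := (R \ P a) \ colorNeighbors c r a with hB
  have hBcard : n + 2 * m + 8 ≤ B.card := by
    have h1 := Finset.le_card_sdiff (colorNeighbors c r a) (R \ P a)
    have h2 := Finset.le_card_sdiff (P a) R
    have := hPcard a ha
    rw [← hB] at h1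
    omega
  have hBmem : ∀ y ∈ B, y ∈ R ∧ n + m + 1 ≤ (colorNeighbors c r y).card ∧
      (colorNeighbors c b y).card ≤ m := by
    intro y hy
    rw [hB, Finset.mem_sdiff, Finset.mem_sdiff, mem_colorNeighbors] at hy
    obtain ⟨⟨hyR, hyP⟩, hyr⟩ := hy
    have hay : a ≠ y := by rintro rfl; exact hyP (hPself _ ha)
    have hc : c a y = b := (hP a ha y hyR hyP).resolve_left fun h => hyr ⟨hay, h⟩
    have := card_colorNeighbors_le hs hb hay hc ha_big
    have := hdeg y hyR
    exact ⟨hyR, by omega, by omega⟩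
  obtain ⟨y, hy⟩ : B.Nonempty := Finset.card_pos.1 (by omega)
  obtain ⟨hyR, hyr, hyb⟩ := hBmem y hy
  have hsub : B \ P y ⊆ colorNeighbors c b y := by
    intro z hz
    rw [Finset.mem_sdiff] at hz
    obtain ⟨hzR, hzr, -⟩ := hBmem z hz.1
    have hyz : y ≠ z := by rintro rfl; exact hz.2 (hPself _ hyR)
    refine mem_colorNeighbors.2 ⟨hyz, (hP y hyR z hzR hz.2).resolve_left fun h => ?_⟩
    have := card_colorNeighbors_le hs hr hyz h hyr
    omega
  have h1 := Finset.card_le_card hsub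
  have h2 := Finset.le_card_sdiff (P y) B
  have := hPcard y hyR
  omega

/-- A set of vertices is homogeneous if each vertex outside it is joined to it in one color. -/
def IsHomogeneous (c : V → V → K) (R : Finset V) : Prop :=
  ∀ t ∉ R, ∀ x ∈ R, ∀ y ∈ R, c t x = c t y

/-- The upper bound. The smallest homogeneous set `R` with more than `n` vertices has a Gallai
partition into parts of size at most `n`, while at most `m` outside vertices are joined to `R` in
each color. All degrees in `R` in the two colors of the partition are at most `n + m`, so the parts
have size at least `3 * m + 8 > (n + 1) / 2`, and three of them contain a double star. -/
theorem exists_hasDoubleStar [Fintype K] (hs : ∀ x y, c x y = c y x) (hc : IsGallaiColoring c)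
    (hn₁ : 1 ≤ n) (hn : n ≤ 6 * m + 6) (hk : 3 ≤ Fintype.card K)
    (hN : 2 * n + 6 * m + 8 + m * (Fintype.card K - 3) ≤ Fintype.card V) :
    ∃ i, HasDoubleStar c i n m := by
  classical
  by_contra! hd
  have hK : Nontrivial K := Fintype.one_lt_card_iff_nontrivial.1 (by omega)
  -- A smallest homogeneous set with more than `n` vertices; its homogeneous proper subsets have at
  -- most `n` vertices.
  obtain ⟨R, hR, hRmin⟩ := Finset.exists_min_image
    (Finset.univ.filter fun R : Finset V => IsHomogeneous c R ∧ n + 1 ≤ R.card) Finset.card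
    ⟨Finset.univ, by
      simp only [Finset.mem_filter, Finset.mem_univ, true_and, Finset.card_univ]
      exact ⟨fun t ht => absurd (Finset.mem_univ t) ht, by omega⟩⟩
  simp only [Finset.mem_filter, Finset.mem_univ, true_and] at hR hRmin
  obtain ⟨hRh, hRn⟩ := hR
  obtain ⟨r, b, hrb, u, hu, v, hv, huv⟩ :=
    exists_ne_not_reachable_otherColors hs hc R (by omega)
  -- The outside vertices by their color to `R`: at most `m` for each color.
  let T : K → Finset V := fun i => Rᶜ.filter fun t => c t u = i
  have hTmem : ∀ i t, t ∈ T i → t ∉ R ∧ ∀ x ∈ R, c t x = i := by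
    intro i t ht
    simp only [T, Finset.mem_filter, Finset.mem_compl] at ht
    exact ⟨ht.1, fun x hx => (hRh t ht.1 x hx u hu).trans ht.2⟩
  have hTcard : ∀ i, (T i).card ≤ m := by
    intro i
    refine card_le_of_complete hs (hd i) (T i) R ?_ (fun t ht x hx => (hTmem i t ht).2 x hx) hRn
    exact Finset.disjoint_left.2 fun t ht => (hTmem i t ht).1
  have hTsum : Rᶜ.card = ∑ i, (T i).card :=
    Finset.card_eq_sum_card_fiberwise fun t _ => Finset.mem_coe.2 (Finset.mem_univ _)
  have hRc : Rᶜ.card + R.card = Fintype.card V := by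
    rw [Finset.card_compl]
    have := Finset.card_le_univ R
    omega
  obtain ⟨k, hk'⟩ : ∃ k, Fintype.card K = k + 3 := ⟨_, (Nat.sub_add_cancel hk).symm⟩
  rw [hk', Nat.add_sub_cancel] at hN
  have hcount : 2 * n + 5 * m + 8 ≤ R.card + (T r).card + (T b).card := by
    have h1 : ∑ i, (T i).card = (T r).card + ((T b).card +
        ∑ i ∈ (Finset.univ.erase r).erase b, (T i).card) := by
      rw [Finset.add_sum_erase _ (fun i => (T i).card) (by simp [hrb.symm]),
        Finset.add_sum_erase _ (fun i => (T i).card) (by simp)]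
    have h2 : ∑ i ∈ (Finset.univ.erase r).erase b, (T i).card ≤ (k + 1) * m := by
      have := Finset.sum_le_card_nsmul ((Finset.univ.erase r).erase b) (fun i => (T i).card) m
        fun i _ => hTcard i
      rwa [Finset.card_erase_of_mem (by simp [hrb.symm]), Finset.card_erase_of_mem (by simp),
        Finset.card_univ, hk', smul_eq_mul] at this
    nlinarith
  have hRcard : 2 * n + 3 * m + 8 ≤ R.card := by
    have := hTcard r
    have := hTcard b
    omega
  -- The Gallai partition of `R`.
  let P : V → Finset V := fun x => R.filter fun y => (otherColors c R r b).Reachable x y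
  have hPmem : ∀ x y, y ∈ P x ↔ y ∈ R ∧ (otherColors c R r b).Reachable x y := by
    intro x y; simp [P]
  have hPself : ∀ x ∈ R, x ∈ P x := fun x hx => (hPmem x x).2 ⟨hx, .rfl⟩
  have hP : ∀ x ∈ R, ∀ y ∈ R, y ∉ P x → c x y = r ∨ c x y = b := fun x hx y hy h =>
    color_of_not_reachable hs hx hy fun h' => h ((hPmem x y).2 ⟨hy, h'⟩)
  have hPcard : ∀ x ∈ R, (P x).card ≤ n := by
    intro x hx
    by_contra! h
    have hsub : P x ⊆ R := Finset.filter_subset _ _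
    have hle := hRmin (P x) ⟨?_, h⟩
    · have heq := Finset.eq_of_subset_of_card_le hsub hle
      rw [← heq, hPmem] at hu hv
      exact huv (hu.2.symm.trans hv.2)
    · intro t ht y hy z hz
      by_cases htR : t ∈ R
      · rw [hPmem] at ht hy hz
        rw [hs t y, hs t z]
        exact color_eq_of_reachable hs hc htR (hy.2.symm.trans hz.2)
          fun h' => ht ⟨htR, hy.2.trans h'⟩
      · exact hRh t htR y (hsub hy) z (hsub hz)
  have hdegP : ∀ x ∈ R, R.card + (T r).card + (T b).card ≤
      (colorNeighbors c r x).card + (colorNeighbors c b x).card + (P x).card := by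
    intro x hx
    have hsub : (R ∪ T r) ∪ T b ⊆ (colorNeighbors c r x ∪ colorNeighbors c b x) ∪ P x := by
      intro y hy
      simp only [Finset.mem_union, mem_colorNeighbors] at hy ⊢
      rcases hy with (hy | hy) | hy
      · by_cases hyP : y ∈ P x
        · exact .inr hyP
        · have hxy : x ≠ y := by rintro rfl; exact hyP (hPself _ hx)
          rcases hP x hx y hy hyP with h | h
          · exact .inl (.inl ⟨hxy, h⟩)
          · exact .inl (.inr ⟨hxy, h⟩)
      · obtain ⟨h1, h2⟩ := hTmem _ _ hy
        exact .inl (.inl ⟨fun h => h1 (h ▸ hx), by rw [hs]; exact h2 x hx⟩)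
      · obtain ⟨h1, h2⟩ := hTmem _ _ hy
        exact .inl (.inr ⟨fun h => h1 (h ▸ hx), by rw [hs]; exact h2 x hx⟩)
    have h1 := Finset.card_le_card hsub
    have h2 := Finset.card_union_le (colorNeighbors c r x ∪ colorNeighbors c b x) (P x)
    have h3 := Finset.card_union_le (colorNeighbors c r x) (colorNeighbors c b x)
    rw [Finset.card_union_of_disjoint, Finset.card_union_of_disjoint] at h1
    · omega
    · exact Finset.disjoint_left.2 fun y hy hy' => (hTmem _ _ hy').1 hy
    · refine Finset.disjoint_left.2 fun y hy hy' => ?_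
      rcases Finset.mem_union.1 hy with hy | hy
      · exact (hTmem _ _ hy').1 hy
      · exact hrb (((hTmem _ _ hy).2 u hu).symm.trans ((hTmem _ _ hy').2 u hu))
  have hout : ∀ i, ∀ x ∈ R, (colorNeighbors c i x \ R).card ≤ m := by
    intro i x hx
    refine (Finset.card_le_card ?_).trans (hTcard i)
    intro y hy
    rw [Finset.mem_sdiff, mem_colorNeighbors] at hy
    simp only [T, Finset.mem_filter, Finset.mem_compl]
    refine ⟨hy.2, ?_⟩
    rw [hRh y hy.2 u hu x hx, hs, hy.1.2]
  have hsmall_r : ∀ x ∈ R, (colorNeighbors c r x).card < n + m + 1 := fun x hx =>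
    card_colorNeighbors_lt hs (hd r) (hd b) R P hRcard hPself hPcard hP (hout r)
      (fun y hy => by have := hdegP y hy; have := hPcard y hy; omega) hx
  have hsmall_b : ∀ x ∈ R, (colorNeighbors c b x).card < n + m + 1 := fun x hx =>
    card_colorNeighbors_lt hs (hd b) (hd r) R P hRcard hPself hPcard
      (fun y hy z hz h => (hP y hy z hz h).symm) (hout b)
      (fun y hy => by have := hdegP y hy; have := hPcard y hy; omega) hx
  -- Hence every part is large.
  have hPlarge : ∀ x ∈ R, 3 * m + 8 ≤ (P x).card := by
    intro x hx
    have := hdegP x hx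
    have := hsmall_r x hx
    have := hsmall_b x hx
    omega
  -- Two of the three edges between three parts have the same color.
  have hcol : ∀ x ∈ R, ∀ y ∈ R, y ∉ P x → ∀ x' ∈ P x, ∀ y' ∈ P y, c x' y' = c x y := by
    intro x hx y hy hxy x' hx' y' hy'
    rw [hPmem] at hx' hy'
    have h1 : ¬(otherColors c R r b).Reachable x y := fun h => hxy ((hPmem x y).2 ⟨hy, h⟩)
    have h2 : c x y = c x' y := color_eq_of_reachable hs hc hy hx'.2 h1
    have h3 : c y x' = c y' x' := color_eq_of_reachable hs hc hx'.1 hy'.2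
      fun h => h1 (hx'.2.trans h.symm)
    rw [h2, hs x' y', ← h3, hs]
  have hdisj : ∀ x ∈ R, ∀ y ∈ R, y ∉ P x → Disjoint (P x) (P y) := by
    intro x hx y hy hxy
    refine Finset.disjoint_left.2 fun z hz hz' => hxy ?_
    rw [hPmem] at hz hz' ⊢
    exact ⟨hy, hz.2.trans hz'.2.symm⟩
  have hsymm : ∀ x ∈ R, ∀ y, y ∈ R → y ∉ P x → x ∉ P y := fun x hx y hy h h' =>
    h ((hPmem x y).2 ⟨hy, ((hPmem y x).1 h').2.symm⟩)
  have hstar : ∀ x ∈ R, ∀ y ∈ R, ∀ z ∈ R, y ∉ P x → z ∉ P x → z ∉ P y → c x y ≠ c x z := by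
    intro x hx y hy z hz hxy hxz hyz heq
    refine hd (c x y) (hasDoubleStar_of_three_sets hs (P x) (P y) (P z) (hdisj x hx y hy hxy)
      (hdisj x hx z hz hxz) (hdisj y hy z hz hyz) (hcol x hx y hy hxy)
      (fun a ha d hd => (hcol x hx z hz hxz a ha d hd).trans heq.symm) ?_ ?_)
    · have := hPlarge x hx
      omega
    · have := hPlarge y hy
      have := hPlarge z hz
      omega
  obtain ⟨y, hy⟩ : (R \ P u).Nonempty := Finset.card_pos.1 (by
    have := Finset.le_card_sdiff (P u) R
    have := hPcard u hu
    omega)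
  rw [Finset.mem_sdiff] at hy
  obtain ⟨z, hz⟩ : ((R \ P u) \ P y).Nonempty := Finset.card_pos.1 (by
    have := Finset.le_card_sdiff (P u) R
    have := Finset.le_card_sdiff (P y) (R \ P u)
    have := hPcard u hu
    have := hPcard y hy.1
    omega)
  rw [Finset.mem_sdiff, Finset.mem_sdiff] at hz
  have hyu := hsymm u hu y hy.1 hy.2
  have hzu := hsymm u hu z hz.1.1 hz.1.2
  have hzy := hsymm y hy.1 z hz.1.1 hz.2
  have h1 := hstar u hu y hy.1 z hz.1.1 hy.2 hz.1.2 hz.2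
  have h2 := hstar y hy.1 u hu z hz.1.1 hyu hz.2 hz.1.2
  have h3 := hstar z hz.1.1 u hu y hy.1 hzu hzy hy.2
  have h4 := hP u hu y hy.1 hy.2
  have h5 := hP u hu z hz.1.1 hz.1.2
  have h6 := hP y hy.1 z hz.1.1 hz.2
  rw [hs y u] at h2
  rw [hs z u, hs z y] at h3
  grind

end

/-! ### The lower bound -/

section

variable {V K : Type*} {c : V → V → K} {C : TopEdgeLabeling V K}

theorem hasRainbowCopy_iff_not_isGallaiColoring (h : ∀ x y hxy, C.get x y hxy = c x y) :
    HasRainbowCopy (completeGraph (Fin 3)) C ↔ ¬IsGallaiColoring c := by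
  rw [hasRainbowCopy_completeGraph_three_iff]
  simp only [h, IsGallaiColoring]
  push Not
  simp only [exists_prop]

theorem hasMonochromaticCopy_iff_hasDoubleStar (h : ∀ x y hxy, C.get x y hxy = c x y) {n m : ℕ} :
    HasMonochromaticCopy (doubleStar n m) C ↔ ∃ i, HasDoubleStar c i n m := by
  simp only [HasMonochromaticCopy, doubleStar_isContained_iff, HasDoubleStar,
    TopEdgeLabeling.labelGraph_adj, h, exists_prop]

theorem HasDoubleStar.map {W L : Type*} {d : W → W → L} (e : V ↪ W) {i : K} {j : L}
    (he : ∀ x y, c x y = i → d (e x) (e y) = j) {n m : ℕ} (h : HasDoubleStar c i n m) :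
    HasDoubleStar d j n m := by
  obtain ⟨u, v, A, B, huv, hA, hB, hAB, hAu, hBv⟩ := h
  refine ⟨e u, e v, A.map e, B.map e, ⟨e.injective.ne huv.1, he _ _ huv.2⟩, by simpa, by simpa,
    (Finset.disjoint_map e).2 hAB, ?_, ?_⟩
  · intro a ha
    obtain ⟨a, ha', rfl⟩ := Finset.mem_map.1 ha
    obtain ⟨⟨h1, h2⟩, h3⟩ := hAu a ha'
    exact ⟨⟨e.injective.ne h1, he _ _ h2⟩, e.injective.ne h3⟩
  · intro a ha
    obtain ⟨a, ha', rfl⟩ := Finset.mem_map.1 ha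
    obtain ⟨⟨h1, h2⟩, h3⟩ := hBv a ha'
    exact ⟨⟨e.injective.ne h1, he _ _ h2⟩, e.injective.ne h3⟩

end

/-- A coloring of the pairs of natural numbers. The first `L` vertices, the core, are colored by
`core`. The later vertices form consecutive blocks of size `m`, colored `z` inside; the block number
`j` is joined to all earlier vertices in the color `p + j`. -/
def blockColoring (L m p z : ℕ) (core : ℕ → ℕ → ℕ) (x y : ℕ) : ℕ :=
  if max x y < L then core x y
  else if L ≤ min x y ∧ (x - L) / m = (y - L) / m then z
  else p + (max x y - L) / m

section

variable {L m p z : ℕ} {core : ℕ → ℕ → ℕ}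

theorem blockColoring_comm (hs : ∀ x y, core x y = core y x) (x y : ℕ) :
    blockColoring L m p z core x y = blockColoring L m p z core y x := by
  simp only [blockColoring, max_comm x y, min_comm x y, hs x y, eq_comm (a := (x - L) / m)]

theorem isGallaiColoring_blockColoring (hs : ∀ x y, core x y = core y x)
    (hc : IsGallaiColoring core) : IsGallaiColoring (blockColoring L m p z core) := by
  set c := blockColoring L m p z core with hcdef
  have hsc : ∀ x y, c x y = c y x := blockColoring_comm hs
  have key : ∀ x y w, x < y → y < w → c x y = c x w ∨ c x y = c y w ∨ c x w = c y w := by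
    intro x y w hxy hyw
    have h1 : (x - L) / m ≤ (y - L) / m := Nat.div_le_div_right (by omega)
    have h2 : (y - L) / m ≤ (w - L) / m := Nat.div_le_div_right (by omega)
    have h3 := hc x y w (by omega) (by omega) (by omega)
    simp only [hcdef, blockColoring, max_eq_right hxy.le, max_eq_right hyw.le,
      max_eq_right (hxy.trans hyw).le, min_eq_left hxy.le, min_eq_left hyw.le,
      min_eq_left (hxy.trans hyw).le]
    generalize (x - L) / m = a at *
    generalize (y - L) / m = b at *
    generalize (w - L) / m = d at *
    generalize core x y = e at *
    generalize core x w = f at *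
    generalize core y w = g at *
    split_ifs <;> omega
  intro x y w hxy hxw hyw
  have := hsc x y
  have := hsc x w
  have := hsc y w
  rcases lt_or_gt_of_ne hxy with h1 | h1 <;> rcases lt_or_gt_of_ne hxw with h2 | h2 <;>
    rcases lt_or_gt_of_ne hyw with h3 | h3
  · have := key x y w h1 h3; omega
  · have := key x w y h2 h3; omega
  · omega
  · have := key w x y h2 h1; omega
  · have := key y x w h1 h2; omega
  · omega
  · have := key y w x h3 h2; omega
  · have := key w y x h3 h1; omega

theorem card_le_of_block (hm : 1 ≤ m) (j : ℕ) (S : Finset ℕ)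
    (hS : ∀ y ∈ S, L ≤ y ∧ (y - L) / m = j) : S.card ≤ m := by
  have hsub : S ⊆ Finset.Ico (L + j * m) (L + j * m + m) := by
    intro y hy
    obtain ⟨h1, h2⟩ := hS y hy
    rw [Nat.div_eq_iff (by omega)] at h2
    rw [Finset.mem_Ico]
    omega
  simpa using Finset.card_le_card hsub

/-- A color of the core may be free of double stars for either of two reasons: small degrees, or a
core with fewer than `n + m + 2` vertices. The color of a block `j` joins its `m` vertices to
earlier ones only, each of degree at most `m`, so one of the centers would lack leaves. -/
theorem not_hasDoubleStar_blockColoring {n : ℕ} (hs : ∀ x y, core x y = core y x)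
    (hm : 1 ≤ m) (hmn : m ≤ n)
    (hcore : L ≤ n + m + 1 ∨ ∀ i < p, ∀ u, ∀ S : Finset ℕ,
      (∀ a ∈ S, a < L ∧ u ≠ a ∧ core u a = i) → S.card ≤ n)
    (hz : z < p) (hp : ∀ x y, core x y < p) (i : ℕ) :
    ¬HasDoubleStar (blockColoring L m p z core) i n m := by
  rintro ⟨u, v, A, B, huv, hA, hB, hAB, hAu, hBv⟩
  have hvA : v ∉ A := fun h => (hAu v h).2 rfl
  have huB : u ∉ B := fun h => (hBv u h).2 rfl
  have huA : u ∉ A := fun h => (hAu u h).1.1 rfl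
  have hvB : v ∉ B := fun h => (hBv v h).1.1 rfl
  have hvu : v ≠ u ∧ blockColoring L m p z core v u = i :=
    ⟨huv.1.symm, by rw [blockColoring_comm hs]; exact huv.2⟩
  have hA' : ∀ a ∈ insert v A, u ≠ a ∧ blockColoring L m p z core u a = i := by
    intro a ha
    rcases Finset.mem_insert.1 ha with rfl | h
    exacts [huv, (hAu a h).1]
  have hB' : ∀ a ∈ insert u B, v ≠ a ∧ blockColoring L m p z core v a = i := by
    intro a ha
    rcases Finset.mem_insert.1 ha with rfl | h
    exacts [hvu, (hBv a h).1]
  have hAc : (insert v A).card = n + 1 := by rw [Finset.card_insert_of_notMem hvA, hA]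
  have hBc : (insert u B).card = m + 1 := by rw [Finset.card_insert_of_notMem huB, hB]
  rcases Nat.lt_or_ge i p with hi | hi
  · have hnbr : ∀ x y, x < L → blockColoring L m p z core x y = i → y < L ∧ core x y = i := by
      intro x y hx h
      have := hp x y
      unfold blockColoring at h
      generalize (max x y - L) / m = a at *
      split_ifs at h <;> omega
    rcases Nat.lt_or_ge u L with hu | hu
    · have hv := (hnbr u v hu huv.2).1
      rcases hcore with hL | hcore
      · have hsub : (insert v A) ∪ (insert u B) ⊆ Finset.range L := by
          intro a ha
          rw [Finset.mem_range]
          rcases Finset.mem_union.1 ha with h | h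
          · exact (hnbr u a hu (hA' a h).2).1
          · exact (hnbr v a hv (hB' a h).2).1
        have := Finset.card_le_card hsub
        rw [Finset.card_union_of_disjoint, Finset.card_range] at this
        · omega
        · rw [Finset.disjoint_insert_left, Finset.disjoint_insert_right, Finset.mem_insert]
          exact ⟨by simp [huv.1.symm, hvB], huA, hAB⟩
      · have := hcore i hi u (insert v A) fun a ha =>
          ⟨(hnbr u a hu (hA' a ha).2).1, (hA' a ha).1, (hnbr u a hu (hA' a ha).2).2⟩
        omega
    · have := card_le_of_block (L := L) hm ((u - L) / m) (insert v A) (by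
        intro a ha
        have h := (hA' a ha).2
        unfold blockColoring at h
        generalize (max u a - L) / m = d at *
        generalize (u - L) / m = b at *
        generalize (a - L) / m = e at *
        split_ifs at h <;> omega)
      omega
  · -- All neighbors of the earlier center `x` lie in block `j`.
    obtain ⟨j, rfl⟩ := Nat.exists_eq_add_of_le hi
    have hnbr : ∀ x y, x < y → blockColoring L m p z core x y = p + j → ∀ S : Finset ℕ,
        (∀ a ∈ S, x ≠ a ∧ blockColoring L m p z core x a = p + j) → S.card ≤ m := by
      intro x y hxy h S hS
      refine card_le_of_block (L := L) hm j S ?_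
      intro a ha
      obtain ⟨hne, h'⟩ := hS a ha
      have h1 := hp x y
      have h2 := hp x a
      unfold blockColoring at h h'
      rw [max_eq_right hxy.le, min_eq_left hxy.le] at h
      rcases lt_or_gt_of_ne hne with h3 | h3
      · rw [max_eq_right h3.le, min_eq_left h3.le] at h'
        generalize (x - L) / m = d at *
        generalize (y - L) / m = b at *
        generalize (a - L) / m = e at *
        split_ifs at h h' <;> omega
      · rw [max_eq_left h3.le, min_eq_right h3.le] at h'
        generalize (x - L) / m = d at *
        generalize (y - L) / m = b at *
        generalize (a - L) / m = e at *
        split_ifs at h h' <;> omega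
    rcases lt_or_gt_of_ne huv.1 with h | h
    · have := hnbr u v h huv.2 _ hA'
      omega
    · have := hnbr v u h hvu.2 _ hB'
      omega

/-- A lower bound for the Gallai-Ramsey number of the double star from a core whose `p` colors
satisfy the conditions of `not_hasDoubleStar_blockColoring`. -/
theorem lt_gallaiRamsey_of_core {n k N : ℕ} (hs : ∀ x y, core x y = core y x)
    (hc : IsGallaiColoring core) (hm : 1 ≤ m) (hmn : m ≤ n)
    (hcore : L ≤ n + m + 1 ∨ ∀ i < p, ∀ u, ∀ S : Finset ℕ,
      (∀ a ∈ S, a < L ∧ u ≠ a ∧ core u a = i) → S.card ≤ n)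
    (hz : z < p) (hp : ∀ x y, core x y < p) (hpk : p ≤ k)
    (hN : ∀ C : TopEdgeLabeling (Fin N) (Fin k),
      HasRainbowCopy (completeGraph (Fin 3)) C ∨ HasMonochromaticCopy (doubleStar n m) C) :
    L + m * (k - p) < N := by
  by_contra! hle
  have hlt : ∀ x y : Fin N, blockColoring L m p z core x y < k := by
    intro x y
    have h1 := hp x y
    have h2 : (max (x : ℕ) y - L) / m < k - p ∨ max (x : ℕ) y < L := by
      rw [Nat.div_lt_iff_lt_mul (by omega), mul_comm]
      omega
    unfold blockColoring
    generalize (max (x : ℕ) y - L) / m = d at *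
    split_ifs <;> omega
  let c : Fin N → Fin N → Fin k := fun x y => ⟨blockColoring L m p z core x y, hlt x y⟩
  let C : TopEdgeLabeling (Fin N) (Fin k) := EdgeLabeling.mk (fun x y _ => c x y)
    fun x y _ => Fin.ext (blockColoring_comm hs _ _)
  have hC : ∀ x y hxy, C.get x y hxy = c x y := fun x y hxy => EdgeLabeling.get_mk _ _ _ _ _
  rcases hN C with h | h
  · rw [hasRainbowCopy_iff_not_isGallaiColoring hC] at h
    refine h fun x y w hxy hxw hyw => ?_
    simpa [c] using isGallaiColoring_blockColoring (L := L) (m := m) (p := p) (z := z) hs hc x y w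
      (Fin.val_injective.ne hxy) (Fin.val_injective.ne hxw) (Fin.val_injective.ne hyw)
  · rw [hasMonochromaticCopy_iff_hasDoubleStar hC] at h
    obtain ⟨i, h⟩ := h
    exact not_hasDoubleStar_blockColoring hs hm hmn hcore hz hp i
      (h.map Fin.valEmbedding fun x y hxy => congrArg Fin.val hxy)

end

/-- The coloring of the pairs of natural numbers obtained from the coloring of `K₅` by two
`5`-cycles by blowing up each vertex to a residue class modulo `5`, with color `2` inside the
classes. -/
def pentagonColoring (x y : ℕ) : ℕ :=
  if x % 5 = y % 5 then 2
  else if (x + 1) % 5 = y % 5 ∨ (y + 1) % 5 = x % 5 then 0 else 1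

theorem pentagonColoring_comm (x y : ℕ) : pentagonColoring x y = pentagonColoring y x := by
  unfold pentagonColoring
  split_ifs <;> omega

theorem pentagonColoring_lt (x y : ℕ) : pentagonColoring x y < 3 := by
  unfold pentagonColoring
  split_ifs <;> omega

theorem isGallaiColoring_pentagonColoring : IsGallaiColoring pentagonColoring := by
  intro x y z _ _ _
  unfold pentagonColoring
  split_ifs <;> omega

theorem card_le_of_two_residues {n a b : ℕ} (hab : a ≠ b) (ha : a < 5) (hb : b < 5) (S : Finset ℕ)
    (hS : ∀ y ∈ S, y < 5 * (n / 2) + n % 2 ∧ (y % 5 = a ∨ y % 5 = b)) : S.card ≤ n := by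
  wlog hlt : a < b generalizing a b
  · exact this hab.symm hb ha (fun y hy => ⟨(hS y hy).1, (hS y hy).2.symm⟩) (by omega)
  -- Enumerate the two classes alternately.
  have := Finset.card_le_card_of_injOn (s := S) (t := Finset.range n)
    (fun y => 2 * (y / 5) + if y % 5 = b then 1 else 0) ?_ ?_
  · simpa using this
  · intro y hy
    have := hS y hy
    simp only [Finset.coe_range, Set.mem_Iio]
    split_ifs <;> omega
  · intro x hx y hy h
    have := hS x hx
    have := hS y hy
    simp only at h
    split_ifs at h <;> omega

theorem card_le_of_pentagonColoring {n i u : ℕ} (S : Finset ℕ)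
    (hS : ∀ y ∈ S, y < 5 * (n / 2) + n % 2 ∧ u ≠ y ∧ pentagonColoring u y = i) :
    S.card ≤ n := by
  obtain ⟨a, b, hab, ha, hb, h⟩ : ∃ a b, a ≠ b ∧ a < 5 ∧ b < 5 ∧ ∀ y,
      pentagonColoring u y = i → y % 5 = a ∨ y % 5 = b := by
    unfold pentagonColoring
    -- Color `2` occurs in the class of `u` only, so the second class is arbitrary there.
    rcases Nat.lt_or_ge 1 i with hi | hi
    · exact ⟨u % 5, (u + 1) % 5, by omega, by omega, by omega, fun y hy => by
        split_ifs at hy <;> omega⟩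
    interval_cases i
    · exact ⟨(u + 1) % 5, (u + 4) % 5, by omega, by omega, by omega, fun y hy => by
        split_ifs at hy
        omega⟩
    · exact ⟨(u + 2) % 5, (u + 3) % 5, by omega, by omega, by omega, fun y hy => by
        split_ifs at hy <;> omega⟩
  exact card_le_of_two_residues hab ha hb S fun y hy => ⟨(hS y hy).1, h y (hS y hy).2.2⟩

theorem lt_gallaiRamsey {n m k N : ℕ} (hm : 1 ≤ m) (hmn : m ≤ n) (hk : 3 ≤ k)
    (hN : ∀ C : TopEdgeLabeling (Fin N) (Fin k),
      HasRainbowCopy (completeGraph (Fin 3)) C ∨ HasMonochromaticCopy (doubleStar n m) C) :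
    max (5 * (n / 2) + n % 2) (n + 3 * m + 1) + m * (k - 3) < N := by
  have h1 := lt_gallaiRamsey_of_core (z := 2) pentagonColoring_comm
    isGallaiColoring_pentagonColoring hm hmn
    (.inr fun i _ u S hS => card_le_of_pentagonColoring (i := i) (u := u) S hS) (by omega)
    pentagonColoring_lt hk hN
  have h2 := lt_gallaiRamsey_of_core (L := n + m + 1) (p := 1) (z := 0) (core := fun _ _ => 0)
    (fun _ _ => rfl) (fun _ _ _ _ _ _ => .inl rfl) hm hmn (.inl le_rfl) (by omega)
    (fun _ _ => by omega) (by omega) hN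
  obtain ⟨k, rfl⟩ := Nat.exists_eq_add_of_le' hk
  have h3 : k + 3 - 1 = k + 2 := by omega
  rw [h3, mul_add] at h2
  rw [Nat.add_sub_cancel] at h1 ⊢
  omega

/-! ### The Gallai-Ramsey number -/

theorem hasRainbowCopy_or_hasMonochromaticCopy {n m k N : ℕ} (hn₁ : 1 ≤ n)
    (hn : n ≤ 6 * m + 6) (hk : 3 ≤ k)
    (hN : 2 * n + 6 * m + 8 + m * (k - 3) ≤ N)
    (C : TopEdgeLabeling (Fin N) (Fin k)) :
    HasRainbowCopy (completeGraph (Fin 3)) C ∨ HasMonochromaticCopy (doubleStar n m) C := by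
  -- The value on the diagonal is arbitrary.
  let c : Fin N → Fin N → Fin k := fun x y =>
    if h : x ≠ y then C.get x y h else ⟨0, by omega⟩
  have hC : ∀ x y hxy, C.get x y hxy = c x y := fun x y hxy => by
    have : x ≠ y := hxy
    simp [c, this]
  have hs : ∀ x y, c x y = c y x := by
    intro x y
    rcases eq_or_ne x y with rfl | h
    · rfl
    · rw [← hC x y h, ← hC y x h.symm, EdgeLabeling.get_comm]
  rw [hasRainbowCopy_iff_not_isGallaiColoring hC, hasMonochromaticCopy_iff_hasDoubleStar hC]
  by_cases h : IsGallaiColoring c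
  · exact .inr (exists_hasDoubleStar hs h hn₁ hn (by simpa) (by simpa))
  · exact .inl h

end SimpleGraph

/-- All natural-number divisions and subtractions below are exact, by the parity of `n` and by
`1 ≤ n` and `3 ≤ k`. -/
theorem mainTheorem2 (n m k : ℕ) (hm : 1 ≤ m) (hmn : m ≤ n) (hn : n ≤ 6 * m + 6) (hk : 3 ≤ k) :
    (Even n →
      SimpleGraph.gallaiRamsey k (SimpleGraph.completeGraph (Fin 3)) (SimpleGraph.doubleStar n m) ≤
        max (5 * ((n + 2) / 2)) (2 * n + 6 * m + 7) + m * (k - 3) + 1) ∧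
    (Odd n →
      SimpleGraph.gallaiRamsey k (SimpleGraph.completeGraph (Fin 3)) (SimpleGraph.doubleStar n m) ≤
        max (5 * ((n + 1) / 2)) (2 * n + 6 * m + 7) + m * (k - 3) + 2) ∧
    (Even n →
      max (5 * (n / 2)) (n + 3 * m + 1) + m * (k - 3) + 1 ≤
        SimpleGraph.gallaiRamsey k (SimpleGraph.completeGraph (Fin 3)) (SimpleGraph.doubleStar n m)) ∧
    (Odd n →
      max (5 * ((n - 1) / 2)) (n + 3 * m) + m * (k - 3) + 2 ≤
        SimpleGraph.gallaiRamsey k (SimpleGraph.completeGraph (Fin 3)) (SimpleGraph.doubleStar n m)) := by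
  have hmem : 2 * n + 6 * m + 8 + m * (k - 3) ∈
      {N : ℕ | ∀ C : SimpleGraph.TopEdgeLabeling (Fin N) (Fin k),
        SimpleGraph.HasRainbowCopy (SimpleGraph.completeGraph (Fin 3)) C ∨
          SimpleGraph.HasMonochromaticCopy (SimpleGraph.doubleStar n m) C} :=
    SimpleGraph.hasRainbowCopy_or_hasMonochromaticCopy (hm.trans hmn) hn hk le_rfl
  have hle : SimpleGraph.gallaiRamsey k (SimpleGraph.completeGraph (Fin 3))
      (SimpleGraph.doubleStar n m) ≤ 2 * n + 6 * m + 8 + m * (k - 3) := Nat.sInf_le hmem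
  have hlt := SimpleGraph.lt_gallaiRamsey hm hmn hk (Nat.sInf_mem (Set.nonempty_of_mem hmem))
  change _ < SimpleGraph.gallaiRamsey k _ _ at hlt
  generalize SimpleGraph.gallaiRamsey k _ _ = g at hle hlt ⊢
  -- As `1 ≤ m` and `n ≤ 6 * m + 6`, the maxima in the upper bounds are `2 * n + 6 * m + 7`.
  refine ⟨fun h => ?_, fun h => ?_, fun h => ?_, fun h => ?_⟩
  · omega
  · omega
  · rw [Nat.even_iff] at h
    omega
  · rw [Nat.odd_iff] at h
    omega
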